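/- Let $K$ be a field and let $E=(E^0,E^1,r,s)$ be an acyclic directed graph (i.e. one with no closed path of length at least one; $E^0$ and $E^1$ are arbitrary sets). The Leavitt path algebra $L_K(E)$ is the associative, not necessarily unital, $K$-algebra generated by $E^0\cup E^1\cup\{e^*\mid e\in E^1\}$ subject to the relations: $vv'=\delta_{v,v'}v$ for $v,v'\in E^0$; $s(e)e=er(e)=e$ and $r(e)e^*=e^*s(e)=e^*$ for $e\in E^1$; $e^*f=\delta_{e,f}r(e)$ for $e,f\in E^1$; and $v=\sum_{e\in s^{-1}(v)}ee^*$ for every $v\in E^0$ for which $s^{-1}(v)$ is finite and non-empty. Regard $L_K(E)$ as a Lie algebra over $K$ with bracket $[a,b]=ab-ba$. If $L_K(E)$ is locally Lie solvable, that is, every finite-dimensional Lie subalgebra of it is solvable, then $L_K(E)$ is Lie solvable, that is, it is a solvable Lie algebra: some term of its derived series is $0$. -/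

import Mathlib

universe u v w

/-- A directed graph `(E⁰, E¹, r, s)` with vertex set `V` and edge set `W`: two arbitrary sets
together with source and range maps (loops and parallel edges are allowed, and there is no
cardinality restriction). -/
structure DirectedGraph (V : Type u) (W : Type v) where
  /-- the source of an edge -/
  s : W → V
  /-- the range of an edge -/
  r : W → V

namespace DirectedGraph

variable {V : Type u} {W : Type v}

/-- A finite path of length at least one: a non-empty sequence of edges `e₁ e₂ … eₙ` with
`r(eᵢ) = s(eᵢ₊₁)`. -/
def IsPath (E : DirectedGraph V W) (p : List W) : Prop :=
  p ≠ [] ∧ p.IsChain (fun e f => E.r e = E.s f)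

/-- A closed path based at `v`: a finite path of length at least one which starts and ends
at `v`. -/
def IsClosedPath (E : DirectedGraph V W) (v : V) (p : List W) : Prop :=
  E.IsPath p ∧ (∀ e ∈ p.head?, E.s e = v) ∧ (∀ e ∈ p.getLast?, E.r e = v)

/-- A graph is acyclic if it has no closed path based at any vertex. -/
def Acyclic (E : DirectedGraph V W) : Prop :=
  ∀ (v : V) (p : List W), ¬ E.IsClosedPath v p

/-- A vertex is regular if it emits at least one and only finitely many edges. -/
def IsRegular (E : DirectedGraph V W) (v : V) : Prop :=
  (E.s ⁻¹' {v}).Nonempty ∧ (E.s ⁻¹' {v}).Finite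

end DirectedGraph

/-- The generators of a Leavitt path algebra: the vertices `v`, the edges `e`, and the ghost
edges `e*`. -/
inductive LeavittGen (V : Type u) (W : Type v) : Type (max u v)
  | vertex : V → LeavittGen V W
  | edge : W → LeavittGen V W
  | ghost : W → LeavittGen V W

/-- The free associative, not necessarily unital, `K`-algebra on the generators: the semigroup
algebra of the free semigroup. -/
abbrev FreeLeavitt (K : Type w) [Field K] (V : Type u) (W : Type v) : Type (max u v w) :=
  MonoidAlgebra K (FreeSemigroup (LeavittGen V W))

namespace FreeLeavitt

variable (K : Type w) [Field K] {V : Type u} {W : Type v}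

/-- A generator, as an element of the free algebra. -/
noncomputable def gen (x : LeavittGen V W) : FreeLeavitt K V W :=
  MonoidAlgebra.single (FreeSemigroup.of x) 1

/-- The generator belonging to a vertex. -/
noncomputable def vertex (v : V) : FreeLeavitt K V W := gen K (LeavittGen.vertex v)

/-- The generator belonging to an edge. -/
noncomputable def edge (e : W) : FreeLeavitt K V W := gen K (LeavittGen.edge e)

/-- The generator `e*` belonging to an edge `e`. -/
noncomputable def ghost (e : W) : FreeLeavitt K V W := gen K (LeavittGen.ghost e)

end FreeLeavitt

open FreeLeavitt in
/-- The defining relations of the Leavitt path algebra. -/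
inductive LeavittRel (K : Type w) [Field K] {V : Type u} {W : Type v} (E : DirectedGraph V W) :
    FreeLeavitt K V W → FreeLeavitt K V W → Prop
  | V_self (v : V) : LeavittRel K E (vertex K v * vertex K v) (vertex K v)
  | V_ne (v v' : V) (h : v ≠ v') : LeavittRel K E (vertex K v * vertex K v') 0
  | E1_source (e : W) : LeavittRel K E (vertex K (E.s e) * edge K e) (edge K e)
  | E1_range (e : W) : LeavittRel K E (edge K e * vertex K (E.r e)) (edge K e)
  | E2_range (e : W) : LeavittRel K E (vertex K (E.r e) * ghost K e) (ghost K e)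
  | E2_source (e : W) : LeavittRel K E (ghost K e * vertex K (E.s e)) (ghost K e)
  | CK1_self (e : W) : LeavittRel K E (ghost K e * edge K e) (vertex K (E.r e))
  | CK1_ne (e f : W) (h : e ≠ f) : LeavittRel K E (ghost K e * edge K f) 0
  | CK2 (v : V) (hv : E.IsRegular v) :
      LeavittRel K E (vertex K v) (∑ e ∈ hv.2.toFinset, edge K e * ghost K e)

/-- The defining relations and their scalar multiples. A ring congruence of an algebra without
unit need not respect scalars, so the scalar multiples have to be listed among its generators. -/
inductive LeavittScalarRel (K : Type w) [Field K] {V : Type u} {W : Type v}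
    (E : DirectedGraph V W) : FreeLeavitt K V W → FreeLeavitt K V W → Prop
  | smul (k : K) {a b : FreeLeavitt K V W} (h : LeavittRel K E a b) :
      LeavittScalarRel K E (k • a) (k • b)

/-- The smallest congruence of the free algebra (for addition, multiplication and scalars) which
contains the defining relations. -/
noncomputable def leavittCon (K : Type w) [Field K] {V : Type u} {W : Type v} (E : DirectedGraph V W) :
    RingCon (FreeLeavitt K V W) :=
  ringConGen (LeavittScalarRel K E)

theorem leavittCon_smul (K : Type w) [Field K] {V : Type u} {W : Type v} (E : DirectedGraph V W)
    (k : K) {a b : FreeLeavitt K V W} (h : leavittCon K E a b) :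
    leavittCon K E (k • a) (k • b) := by
  have key : ∀ a b, RingConGen.Rel (LeavittScalarRel K E) a b →
      RingConGen.Rel (LeavittScalarRel K E) (k • a) (k • b) := by
    intro a b h
    induction h with
    | of x y h =>
      obtain ⟨l, h⟩ := h
      rw [smul_smul, smul_smul]
      exact .of _ _ (.smul _ h)
    | refl x => exact .refl _
    | symm _ ih => exact .symm ih
    | trans _ _ ih₁ ih₂ => exact .trans ih₁ ih₂
    | add _ _ ih₁ ih₂ => rw [smul_add, smul_add]; exact .add ih₁ ih₂
    | mul _ h ih₁ _ =>
      rw [← smul_mul_assoc, ← smul_mul_assoc]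
      exact .mul ih₁ h
  exact key a b h

/-- The Leavitt path algebra `L_K(E)`: the associative (not necessarily unital) `K`-algebra
generated by the vertices, edges and ghost edges of `E`, subject to (V), (E1), (E2), (CK1),
(CK2). -/
def LeavittPathAlgebra (K : Type w) [Field K] {V : Type u} {W : Type v} (E : DirectedGraph V W) :
    Type (max u v w) :=
  (leavittCon K E).Quotient

namespace LeavittPathAlgebra

variable (K : Type w) [Field K] {V : Type u} {W : Type v} (E : DirectedGraph V W)

noncomputable instance : NonUnitalRing (LeavittPathAlgebra K E) :=
  inferInstanceAs (NonUnitalRing (leavittCon K E).Quotient)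

/-- The quotient map from the free algebra. -/
noncomputable def mk (a : FreeLeavitt K V W) : LeavittPathAlgebra K E :=
  ((a : (leavittCon K E).Quotient))

theorem mk_surjective : Function.Surjective (mk K E) := Quotient.mk''_surjective

/-- The quotient map as an additive homomorphism. -/
noncomputable def mkAddHom : FreeLeavitt K V W →+ LeavittPathAlgebra K E where
  toFun := mk K E
  map_zero' := rfl
  map_add' _ _ := rfl

noncomputable instance : SMul K (LeavittPathAlgebra K E) where
  smul k := Quotient.map' (k • ·) fun _ _ h => leavittCon_smul K E k h

noncomputable instance : Module K (LeavittPathAlgebra K E) :=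
  Function.Surjective.module K (mkAddHom K E) (mk_surjective K E) fun _ _ => rfl

instance : IsScalarTower K (LeavittPathAlgebra K E) (LeavittPathAlgebra K E) where
  smul_assoc k x y := by
    obtain ⟨a, rfl⟩ := mk_surjective K E x
    obtain ⟨b, rfl⟩ := mk_surjective K E y
    exact congrArg (mk K E) (smul_mul_assoc k a b)

instance : SMulCommClass K (LeavittPathAlgebra K E) (LeavittPathAlgebra K E) where
  smul_comm k x y := by
    obtain ⟨a, rfl⟩ := mk_surjective K E x
    obtain ⟨b, rfl⟩ := mk_surjective K E y
    exact congrArg (mk K E) (mul_smul_comm k a b).symm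

/-- The Lie bracket `[a, b] = ab - ba`. -/
noncomputable instance : Bracket (LeavittPathAlgebra K E) (LeavittPathAlgebra K E) where
  bracket a b := a * b - b * a

theorem lie_def (a b : LeavittPathAlgebra K E) : ⁅a, b⁆ = a * b - b * a := rfl

noncomputable instance : LieRing (LeavittPathAlgebra K E) where
  add_lie _ _ _ := by simp only [lie_def, add_mul, mul_add]; abel
  lie_add _ _ _ := by simp only [lie_def, add_mul, mul_add]; abel
  lie_self _ := by simp only [lie_def, sub_self]
  leibniz_lie _ _ _ := by simp only [lie_def, mul_sub, sub_mul, mul_assoc]; abel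

/-- The Lie algebra `L_K(E)⁻` associated to the associative algebra `L_K(E)`. -/
noncomputable instance : LieAlgebra K (LeavittPathAlgebra K E) where
  lie_smul k a b := by simp only [lie_def, mul_smul_comm, smul_mul_assoc, smul_sub]

/-- `L_K(E)` is Lie solvable if the Lie algebra `L_K(E)⁻` is solvable. -/
def LieSolvable : Prop := LieAlgebra.IsSolvable (LeavittPathAlgebra K E)

/-- `L_K(E)` is locally Lie solvable if every finite-dimensional Lie subalgebra of `L_K(E)⁻` is
solvable. -/
def LocallyLieSolvable : Prop :=
  ∀ L : LieSubalgebra K (LeavittPathAlgebra K E), FiniteDimensional K L → LieAlgebra.IsSolvable L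

end LeavittPathAlgebra

/-! Three paths ending at a common vertex `w`, none an initial segment of another, give 3 × 3 matrix
units. Each off-diagonal unit is a bracket of two others, so local solvability forces `w = 0`
(`eq_zero_of_matrixUnits`). Acyclicity supplies such triples whenever two edges are composable or
two distinct edges share a range. Whether vertices are nonzero never matters: the forbidden
configurations are not excluded, but everything factoring through their end vertex vanishes.

What remains is spanned by `v`, `e`, `e*`, `ee*`, and each edge contributes a block multiplying like
2 × 2 matrices, distinct blocks being orthogonal. The triple `e`, `e*`, `ee* - r(e)` behaves like
sl₂, which is perfect when 2 is invertible, so `2e = 0` in every characteristic (`two_smul_edg`).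
The derived series then descends from trace-zero elements to diagonal trace-zero elements to 0. -/

/-! ### Solvability tested on spanning sets -/

section Lie

variable {K L : Type*} [CommRing K] [LieRing L] [LieAlgebra K L]

/-- In a Lie algebra with solvable finite-dimensional subalgebras, a set `T` all of whose elements
are multiples of brackets of elements of `T` is zero, if it lies in a finitely generated
subalgebra. -/
theorem eq_zero_of_perfect_of_locallySolvable
    (h : ∀ M : LieSubalgebra K L, Module.Finite K M → LieAlgebra.IsSolvable M)
    {S T : Set L} (hfin : S.Finite)
    (hS : ∀ x ∈ S, ∀ y ∈ S, ⁅x, y⁆ ∈ Submodule.span K S) (hTS : T ⊆ Submodule.span K S)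
    (hT : ∀ t ∈ T, ∃ c : K, ∃ x ∈ T, ∃ y ∈ T, t = c • ⁅x, y⁆) {t : L} (ht : t ∈ T) : t = 0 := by
  let M : LieSubalgebra K L :=
    { Submodule.span K S with
      lie_mem' := by
        intro x y hx hy
        induction hx, hy using Submodule.span_induction₂ with
        | mem_mem x y hx hy => exact hS x hx y hy
        | zero_left y hy => rw [zero_lie]; exact Submodule.zero_mem _
        | zero_right x hx => rw [lie_zero]; exact Submodule.zero_mem _
        | add_left x y z _ _ _ h₁ h₂ => rw [add_lie]; exact Submodule.add_mem _ h₁ h₂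
        | add_right x y z _ _ _ h₁ h₂ => rw [lie_add]; exact Submodule.add_mem _ h₁ h₂
        | smul_left r x y _ _ h => rw [smul_lie]; exact Submodule.smul_mem _ _ h
        | smul_right r x y _ _ h => rw [lie_smul]; exact Submodule.smul_mem _ _ h }
  have hM : Module.Finite K M := Module.Finite.span_of_finite K hfin
  have hsol := h M hM
  obtain ⟨k, hk⟩ := LieAlgebra.IsSolvable.solvable K M
  -- `T` reproduces itself under brackets, so it survives in every term of the derived series,
  -- including the one that is zero.
  have key : ∀ n, ∀ t (ht : t ∈ T),
      (⟨t, hTS ht⟩ : M) ∈ LieAlgebra.derivedSeries K M n := by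
    intro n
    induction n with
    | zero => intro t ht; simp
    | succ n ih =>
      intro t ht
      obtain ⟨c, x, hx, y, hy, e⟩ := hT t ht
      have e' : (⟨t, hTS ht⟩ : M) = c • ⁅(⟨x, hTS hx⟩ : M), (⟨y, hTS hy⟩ : M)⁆ :=
        Subtype.ext e
      rw [e', LieAlgebra.derivedSeries_def, LieAlgebra.derivedSeriesOfIdeal_succ]
      exact Submodule.smul_mem _ _ (LieSubmodule.lie_mem_lie (ih x hx) (ih y hy))
  have := key k t ht
  rw [hk, LieSubmodule.mem_bot] at this
  exact congrArg Subtype.val this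

/-- A bound for the bracket of an ideal with itself, tested on a spanning set. -/
theorem lieIdeal_lie_self_le {I : LieIdeal K L} {A : Set L} {P : Submodule K L}
    (hI : I.toSubmodule ≤ Submodule.span K A) (hA : ∀ x ∈ A, ∀ y ∈ A, ⁅x, y⁆ ∈ P) :
    (⁅I, I⁆ : LieIdeal K L).toSubmodule ≤ P := by
  rw [LieSubmodule.lieIdeal_oper_eq_linear_span, Submodule.span_le]
  rintro _ ⟨x, y, rfl⟩
  have hx := hI x.2
  have hy := hI y.2
  generalize (x : L) = x at hx
  generalize (y : L) = y at hy
  change ⁅x, y⁆ ∈ P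
  induction hx, hy using Submodule.span_induction₂ with
  | mem_mem x y hx hy => exact hA x hx y hy
  | zero_left y hy => rw [zero_lie]; exact Submodule.zero_mem _
  | zero_right x hx => rw [lie_zero]; exact Submodule.zero_mem _
  | add_left x y z _ _ _ h₁ h₂ => rw [add_lie]; exact Submodule.add_mem _ h₁ h₂
  | add_right x y z _ _ _ h₁ h₂ => rw [lie_add]; exact Submodule.add_mem _ h₁ h₂
  | smul_left r x y _ _ h => rw [smul_lie]; exact Submodule.smul_mem _ _ h
  | smul_right r x y _ _ h => rw [lie_smul]; exact Submodule.smul_mem _ _ h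

end Lie

namespace DirectedGraph.Acyclic

variable {V : Type u} {W : Type v} {E : DirectedGraph V W}

theorem range_ne_source (hE : E.Acyclic) (e : W) : E.r e ≠ E.s e := by
  intro h
  exact hE (E.s e) [e] ⟨⟨by simp, by simp⟩, by simp, by simp [h]⟩

theorem range_ne_source_of_path (hE : E.Acyclic) {e f : W} (hef : E.r e = E.s f) :
    E.r f ≠ E.s e := by
  intro h
  exact hE (E.s e) [e, f] ⟨⟨by simp, by simp [hef]⟩, by simp, by simp [h]⟩

end DirectedGraph.Acyclic

/-! ### Products of the generators -/

namespace LeavittPathAlgebra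

variable (K : Type w) [Field K] {V : Type u} {W : Type v} (E : DirectedGraph V W)

/-- A vertex as an element of the Leavitt path algebra. -/
noncomputable def vtx (v : V) : LeavittPathAlgebra K E := mk K E (FreeLeavitt.vertex K v)

/-- An edge as an element of the Leavitt path algebra. -/
noncomputable def edg (e : W) : LeavittPathAlgebra K E := mk K E (FreeLeavitt.edge K e)

/-- A ghost edge as an element of the Leavitt path algebra. -/
noncomputable def gho (e : W) : LeavittPathAlgebra K E := mk K E (FreeLeavitt.ghost K e)

/-- The idempotent `e e*`. -/
noncomputable def edgeProj (e : W) : LeavittPathAlgebra K E := edg K E e * gho K E e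

variable {E}

theorem mk_eq_of_rel {a b : FreeLeavitt K V W} (h : LeavittRel K E a b) :
    mk K E a = mk K E b := by
  have : LeavittScalarRel K E a b := by simpa using LeavittScalarRel.smul (1 : K) h
  exact (RingCon.eq _).2 (.of _ _ this)

open Classical in
theorem vtx_mul_vtx (v v' : V) :
    vtx K E v * vtx K E v' = if v = v' then vtx K E v else 0 := by
  split_ifs with h
  · subst h; exact mk_eq_of_rel K (.V_self v)
  · exact mk_eq_of_rel K (.V_ne v v' h)

theorem source_mul_edg (e : W) : vtx K E (E.s e) * edg K E e = edg K E e :=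
  mk_eq_of_rel K (.E1_source e)

theorem edg_mul_range (e : W) : edg K E e * vtx K E (E.r e) = edg K E e :=
  mk_eq_of_rel K (.E1_range e)

theorem range_mul_gho (e : W) : vtx K E (E.r e) * gho K E e = gho K E e :=
  mk_eq_of_rel K (.E2_range e)

theorem gho_mul_source (e : W) : gho K E e * vtx K E (E.s e) = gho K E e :=
  mk_eq_of_rel K (.E2_source e)

open Classical in
theorem gho_mul_edg (e f : W) :
    gho K E e * edg K E f = if e = f then vtx K E (E.r e) else 0 := by
  split_ifs with h
  · subst h; exact mk_eq_of_rel K (.CK1_self e)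
  · exact mk_eq_of_rel K (.CK1_ne e f h)

open Classical in
theorem vtx_mul_edg (v : V) (e : W) :
    vtx K E v * edg K E e = if v = E.s e then edg K E e else 0 := by
  rw [← source_mul_edg, ← mul_assoc, vtx_mul_vtx]
  split_ifs with h
  · rw [h]
  · rw [zero_mul]

open Classical in
theorem edg_mul_vtx (v : V) (e : W) :
    edg K E e * vtx K E v = if v = E.r e then edg K E e else 0 := by
  rw [← edg_mul_range, mul_assoc, vtx_mul_vtx]
  simp only [eq_comm (a := v)]
  split_ifs with h
  · rfl
  · rw [mul_zero]

open Classical in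
theorem vtx_mul_gho (v : V) (e : W) :
    vtx K E v * gho K E e = if v = E.r e then gho K E e else 0 := by
  rw [← range_mul_gho, ← mul_assoc, vtx_mul_vtx]
  split_ifs with h
  · rw [h]
  · rw [zero_mul]

open Classical in
theorem gho_mul_vtx (v : V) (e : W) :
    gho K E e * vtx K E v = if v = E.s e then gho K E e else 0 := by
  rw [← gho_mul_source, mul_assoc, vtx_mul_vtx]
  simp only [eq_comm (a := v)]
  split_ifs with h
  · rfl
  · rw [mul_zero]

/-! ### Matrix units -/

section MatrixUnits

variable {K}
variable {ι : Type*} [DecidableEq ι] {a b : ι → LeavittPathAlgebra K E}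
  {w : LeavittPathAlgebra K E}

theorem matrixUnit_mul (hba : ∀ i j, b i * a j = if i = j then w else 0)
    (haw : ∀ i, a i * w = a i) (i j k l : ι) :
    a i * b j * (a k * b l) = if j = k then a i * b l else 0 := by
  rw [mul_assoc, ← mul_assoc (b j), hba]
  split_ifs
  · rw [← mul_assoc, haw]
  · rw [zero_mul, mul_zero]

theorem lie_matrixUnit_mem_span (hba : ∀ i j, b i * a j = if i = j then w else 0)
    (haw : ∀ i, a i * w = a i) :
    ∀ x ∈ Set.range (fun p : ι × ι => a p.1 * b p.2),
      ∀ y ∈ Set.range (fun p : ι × ι => a p.1 * b p.2),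
        ⁅x, y⁆ ∈ Submodule.span K (Set.range (fun p : ι × ι => a p.1 * b p.2)) := by
  rintro _ ⟨⟨i, j⟩, rfl⟩ _ ⟨⟨k, l⟩, rfl⟩
  have hm : ∀ i j, a i * b j ∈ Submodule.span K (Set.range (fun p : ι × ι => a p.1 * b p.2)) :=
    fun i j => Submodule.subset_span ⟨(i, j), rfl⟩
  simp only [lie_def, matrixUnit_mul hba haw]
  refine Submodule.sub_mem _ ?_ ?_ <;> split_ifs <;> first | exact hm _ _ | exact Submodule.zero_mem _

/-- Matrix units of size at least three in a locally Lie solvable algebra vanish. -/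
theorem eq_zero_of_matrixUnits [Finite ι] (h : LocallyLieSolvable K E)
    (hι : ∀ i j : ι, ∃ k, k ≠ i ∧ k ≠ j) [Nontrivial ι]
    (hba : ∀ i j, b i * a j = if i = j then w else 0)
    (haw : ∀ i, a i * w = a i) : w = 0 := by
  obtain ⟨i, j, hij⟩ := exists_pair_ne ι
  have hz : a i * b j = 0 := by
    refine eq_zero_of_perfect_of_locallySolvable h
      (T := {x | ∃ i j, i ≠ j ∧ x = a i * b j}) (Set.finite_range _)
      (lie_matrixUnit_mem_span hba haw) ?_ ?_ ⟨i, j, hij, rfl⟩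
    · rintro _ ⟨i, j, -, rfl⟩
      exact Submodule.subset_span ⟨(i, j), rfl⟩
    · rintro _ ⟨i, j, hij, rfl⟩
      obtain ⟨k, hki, hkj⟩ := hι i j
      -- The third index gives `[E_ik, E_kj] = E_ij`; the reversed product vanishes because `i ≠ j`.
      refine ⟨1, _, ⟨i, k, hki.symm, rfl⟩, _, ⟨k, j, hkj, rfl⟩, ?_⟩
      rw [one_smul, lie_def, matrixUnit_mul hba haw, matrixUnit_mul hba haw,
        if_pos rfl, if_neg hij.symm, sub_zero]
  have hw : w * w = 0 := by
    calc w * w = b i * a i * (b j * a j) := by simp only [hba, if_true]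
      _ = b i * (a i * b j) * a j := by simp only [mul_assoc]
      _ = 0 := by rw [hz, mul_zero, zero_mul]
  calc w = b i * a i := by rw [hba, if_pos rfl]
    _ = b i * (a i * w) := by rw [haw]
    _ = w * w := by rw [← mul_assoc, hba, if_pos rfl]
    _ = 0 := hw

end MatrixUnits

/-! ### Configurations killed by local solvability -/

variable {K}

/-- In characteristic 2 there is nothing to prove. Otherwise `e`, `e*`, `ee* - r(e)` satisfy the sl₂
relations, and dividing by 2 makes each a multiple of a bracket of the others. -/
theorem two_smul_edg (hE : E.Acyclic) (h : LocallyLieSolvable K E) (e : W) :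
    (2 : K) • edg K E e = 0 := by
  by_cases h2 : (2 : K) = 0
  · rw [h2, zero_smul]
  have hr := hE.range_ne_source e
  set A := edg K E e with hA
  set B := gho K E e with hB
  set w := vtx K E (E.r e) with hw
  have hww : w * w = w := by simp [hw, vtx_mul_vtx]
  have hBA : B * A = w := by simp [hA, hB, hw, gho_mul_edg]
  have hwA : w * A = 0 := by simp [hA, hw, vtx_mul_edg, hr]
  have hBw : B * w = 0 := by simp [hB, hw, gho_mul_vtx, hr]
  have hAw : A * w = A := edg_mul_range K e
  have hwB : w * B = B := range_mul_gho K e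
  have hAA : A * A = 0 := by rw [← hAw, mul_assoc, ← mul_assoc w, hwA, zero_mul, mul_zero]
  have hBB : B * B = 0 := by rw [← hwB, mul_assoc, ← mul_assoc B, hBw, zero_mul, mul_zero]
  have hcA : ⁅A * B - w, A⁆ = (2 : K) • A := by
    rw [lie_def, sub_mul, mul_sub, mul_assoc, hBA, hAw, hwA, ← mul_assoc, hAA, zero_mul, two_smul]
    abel
  have hcB : ⁅A * B - w, B⁆ = -((2 : K) • B) := by
    rw [lie_def, sub_mul, mul_sub, mul_assoc, hBB, hwB, hBw, ← mul_assoc, hBA, hwB, two_smul,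
      mul_zero]
    abel
  have hAB : ⁅A, B⁆ = A * B - w := by rw [lie_def, hBA]
  let T : Set (LeavittPathAlgebra K E) := {A, B, A * B - w}
  have mA : A ∈ T := by simp [T]
  have mB : B ∈ T := by simp [T]
  have mC : A * B - w ∈ T := by simp [T]
  have sA := Submodule.subset_span (R := K) mA
  have sB := Submodule.subset_span (R := K) mB
  have sC := Submodule.subset_span (R := K) mC
  have hz : A = 0 := by
    refine eq_zero_of_perfect_of_locallySolvable h (S := T) (T := T) (Set.toFinite _) ?_
      Submodule.subset_span ?_ mA
    · have hneg : ∀ x y : LeavittPathAlgebra K E, ⁅x, y⁆ ∈ Submodule.span K T →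
          ⁅y, x⁆ ∈ Submodule.span K T := fun x y hxy => by
        rw [← lie_skew]; exact Submodule.neg_mem _ hxy
      have h₁ : ⁅A, B⁆ ∈ Submodule.span K T := by rw [hAB]; exact sC
      have h₂ : ⁅A * B - w, A⁆ ∈ Submodule.span K T := by
        rw [hcA]; exact Submodule.smul_mem _ _ sA
      have h₃ : ⁅A * B - w, B⁆ ∈ Submodule.span K T := by
        rw [hcB]; exact Submodule.neg_mem _ (Submodule.smul_mem _ _ sB)
      have h₀ : ∀ x : LeavittPathAlgebra K E, ⁅x, x⁆ ∈ Submodule.span K T := fun x => by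
        rw [lie_self]; exact Submodule.zero_mem _
      rintro x (rfl | rfl | rfl) y (rfl | rfl | rfl)
      exacts [h₀ _, h₁, hneg _ _ h₂, hneg _ _ h₁, h₀ _, hneg _ _ h₃, h₂, h₃, h₀ _]
    · rintro x (rfl | rfl | rfl)
      · exact ⟨2⁻¹, _, mC, _, mA, by rw [hcA, smul_smul, inv_mul_cancel₀ h2, one_smul]⟩
      · exact ⟨-2⁻¹, _, mC, _, mB, by
          rw [hcB, smul_neg, neg_smul, neg_neg, smul_smul, inv_mul_cancel₀ h2, one_smul]⟩
      · exact ⟨1, _, mA, _, mB, by rw [hAB, one_smul]⟩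
  rw [hz, smul_zero]

theorem fin_three_exists_ne (i j : Fin 3) : ∃ k, k ≠ i ∧ k ≠ j := by
  revert i j; decide

/-- The three paths into `r(f)` are `ef`, `f` and the trivial one; acyclicity makes them orthogonal.
-/
theorem vtx_range_eq_zero_of_path (hE : E.Acyclic) (h : LocallyLieSolvable K E) {e f : W}
    (hef : E.r e = E.s f) : vtx K E (E.r f) = 0 := by
  have hf := hE.range_ne_source f
  have he := hE.range_ne_source_of_path hef
  have hne : e ≠ f := by rintro rfl; exact hf hef
  have h₁ : gho K E e * (edg K E e * edg K E f) = edg K E f := by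
    rw [← mul_assoc, gho_mul_edg, if_pos rfl, hef, source_mul_edg]
  refine eq_zero_of_matrixUnits h fin_three_exists_ne
    (a := ![edg K E e * edg K E f, edg K E f, vtx K E (E.r f)])
    (b := ![gho K E f * gho K E e, gho K E f, vtx K E (E.r f)]) ?_ ?_
  · intro i j
    fin_cases i <;> fin_cases j <;>
      simp [mul_assoc, h₁, gho_mul_edg, vtx_mul_vtx, vtx_mul_edg, gho_mul_vtx, hf, he, hne] <;>
      simp [← mul_assoc, gho_mul_edg, vtx_mul_edg, hne.symm, he]
  · intro i
    fin_cases i <;> simp [mul_assoc, edg_mul_range, vtx_mul_vtx]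

/-- Here the three paths are `e`, `f` and the trivial one. -/
theorem vtx_range_eq_zero_of_ne (hE : E.Acyclic) (h : LocallyLieSolvable K E) {e f : W}
    (hne : e ≠ f) (hef : E.r e = E.r f) : vtx K E (E.r f) = 0 := by
  have hf := hE.range_ne_source f
  have he := hE.range_ne_source e
  rw [hef] at he
  refine eq_zero_of_matrixUnits h fin_three_exists_ne
    (a := ![edg K E e, edg K E f, vtx K E (E.r f)])
    (b := ![gho K E e, gho K E f, vtx K E (E.r f)]) ?_ ?_
  · intro i j
    fin_cases i <;> fin_cases j <;>
      simp [gho_mul_edg, vtx_mul_vtx, vtx_mul_edg, gho_mul_vtx, hf, he, hne, hne.symm, hef]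
  · intro i
    fin_cases i <;> simp [edg_mul_vtx, vtx_mul_vtx, hef]

theorem edg_eq_zero {e : W} (h : vtx K E (E.r e) = 0) : edg K E e = 0 := by
  rw [← edg_mul_range, h, mul_zero]

theorem gho_eq_zero {e : W} (h : vtx K E (E.r e) = 0) : gho K E e = 0 := by
  rw [← range_mul_gho, h, zero_mul]

/-! ### Multiplication table of the surviving monomials -/

section Table

variable (hE : E.Acyclic) (h : LocallyLieSolvable K E)
include hE h

theorem range_mul_edg (e f : W) : vtx K E (E.r e) * edg K E f = 0 := by
  rw [vtx_mul_edg]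
  split_ifs with hef
  · exact edg_eq_zero (vtx_range_eq_zero_of_path hE h hef)
  · rfl

theorem gho_mul_range (e f : W) : gho K E f * vtx K E (E.r e) = 0 := by
  rw [gho_mul_vtx]
  split_ifs with hef
  · exact gho_eq_zero (vtx_range_eq_zero_of_path hE h hef)
  · rfl

theorem edg_mul_edg (e f : W) : edg K E e * edg K E f = 0 := by
  rw [← edg_mul_range, mul_assoc, range_mul_edg hE h, mul_zero]

theorem gho_mul_gho (e f : W) : gho K E e * gho K E f = 0 := by
  rw [← range_mul_gho K f, ← mul_assoc, gho_mul_range hE h, zero_mul]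

open Classical in
theorem range_mul_range (e f : W) :
    vtx K E (E.r e) * vtx K E (E.r f) = if e = f then vtx K E (E.r e) else 0 := by
  rw [vtx_mul_vtx]
  by_cases hne : e = f
  · simp [hne]
  -- Distinct edges may share a range, but then that vertex is zero, so the orthogonality of blocks
  -- still holds.
  · rw [if_neg hne]
    split_ifs with hr
    · rw [hr, vtx_range_eq_zero_of_ne hE h hne hr]
    · rfl

open Classical in
theorem edg_mul_range_eq (e f : W) :
    edg K E e * vtx K E (E.r f) = if e = f then edg K E e else 0 := by
  rw [← edg_mul_range, mul_assoc, range_mul_range hE h]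
  split_ifs <;> simp

open Classical in
theorem range_mul_gho_eq (e f : W) :
    vtx K E (E.r e) * gho K E f = if e = f then gho K E f else 0 := by
  rw [← range_mul_gho, ← mul_assoc, range_mul_range hE h]
  split_ifs with hef
  · rw [hef]
  · simp

open Classical in
theorem edg_mul_gho (e f : W) :
    edg K E e * gho K E f = if e = f then edgeProj K E e else 0 := by
  rw [← edg_mul_range, mul_assoc, range_mul_gho_eq hE h]
  split_ifs with hef
  · rw [hef, edgeProj]
  · simp

omit hE h in
open Classical in
theorem vtx_mul_edgeProj (v : V) (e : W) :
    vtx K E v * edgeProj K E e = if v = E.s e then edgeProj K E e else 0 := by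
  rw [edgeProj, ← mul_assoc, vtx_mul_edg]
  split_ifs <;> simp

omit hE h in
open Classical in
theorem edgeProj_mul_vtx (v : V) (e : W) :
    edgeProj K E e * vtx K E v = if v = E.s e then edgeProj K E e else 0 := by
  rw [edgeProj, mul_assoc, gho_mul_vtx]
  split_ifs <;> simp

theorem range_mul_edgeProj (e f : W) : vtx K E (E.r e) * edgeProj K E f = 0 := by
  rw [edgeProj, ← mul_assoc, range_mul_edg hE h, zero_mul]

theorem edgeProj_mul_range (e f : W) : edgeProj K E f * vtx K E (E.r e) = 0 := by
  rw [edgeProj, mul_assoc, gho_mul_range hE h, mul_zero]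

theorem edg_mul_edgeProj (e f : W) : edg K E e * edgeProj K E f = 0 := by
  rw [edgeProj, ← mul_assoc, edg_mul_edg hE h, zero_mul]

theorem edgeProj_mul_gho (e f : W) : edgeProj K E f * gho K E e = 0 := by
  rw [edgeProj, mul_assoc, gho_mul_gho hE h, mul_zero]

omit hE h in
open Classical in
theorem edgeProj_mul_edg (e f : W) :
    edgeProj K E e * edg K E f = if e = f then edg K E e else 0 := by
  rw [edgeProj, mul_assoc, gho_mul_edg]
  split_ifs <;> simp [edg_mul_range]

omit hE h in
open Classical in
theorem gho_mul_edgeProj (e f : W) :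
    gho K E e * edgeProj K E f = if e = f then gho K E e else 0 := by
  rw [edgeProj, ← mul_assoc, gho_mul_edg]
  split_ifs with hef
  · rw [← hef, range_mul_gho]
  · simp

omit hE h in
open Classical in
theorem edgeProj_mul_edgeProj (e f : W) :
    edgeProj K E e * edgeProj K E f = if e = f then edgeProj K E e else 0 := by
  rw [edgeProj, mul_assoc, gho_mul_edgeProj]
  split_ifs <;> simp

end Table

/-! ### Spanning sets for the derived series -/

variable (K E)

/-- The set of all `v`, `e`, `e*` and `e e*`. -/
def shortMonomials : Set (LeavittPathAlgebra K E) :=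
  Set.range (vtx K E) ∪ Set.range (edg K E) ∪ Set.range (gho K E) ∪ Set.range (edgeProj K E)

/-- The set of all `r(e) - e e*`. -/
def traceZeroDiagonal : Set (LeavittPathAlgebra K E) :=
  Set.range fun e => vtx K E (E.r e) - edgeProj K E e

/-- The set of all `e`, `e*` and `r(e) - e e*`. -/
def traceZeroMonomials : Set (LeavittPathAlgebra K E) :=
  Set.range (edg K E) ∪ Set.range (gho K E) ∪ traceZeroDiagonal K E

variable {K E}

theorem span_shortMonomials (hE : E.Acyclic) (h : LocallyLieSolvable K E) :
    Submodule.span K (shortMonomials K E) = ⊤ := by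
  set P := Submodule.span K (shortMonomials K E)
  have mv : ∀ v, vtx K E v ∈ P := fun v => Submodule.subset_span (by simp [shortMonomials])
  have me : ∀ e, edg K E e ∈ P := fun e => Submodule.subset_span (by simp [shortMonomials])
  have mg : ∀ e, gho K E e ∈ P := fun e => Submodule.subset_span (by simp [shortMonomials])
  have mp : ∀ e, edgeProj K E e ∈ P := fun e => Submodule.subset_span (by simp [shortMonomials])
  have m0 : (0 : LeavittPathAlgebra K E) ∈ P := P.zero_mem
  -- Words are built by prepending letters, so stability under left multiplication by generators
  -- suffices.
  have hmul : ∀ g : LeavittGen V W, ∀ x ∈ P, mk K E (FreeLeavitt.gen K g) * x ∈ P := by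
    intro g x hx
    induction hx using Submodule.span_induction with
    | mem x hx =>
      rcases g with v | e | e
      · change vtx K E v * x ∈ P
        obtain ((⟨v', rfl⟩ | ⟨f, rfl⟩) | ⟨f, rfl⟩) | ⟨f, rfl⟩ := hx
        · rw [vtx_mul_vtx]; split_ifs <;> simp only [mv, m0]
        · rw [vtx_mul_edg]; split_ifs <;> simp only [me, m0]
        · rw [vtx_mul_gho]; split_ifs <;> simp only [mg, m0]
        · rw [vtx_mul_edgeProj]; split_ifs <;> simp only [mp, m0]
      · change edg K E e * x ∈ P
        obtain ((⟨v', rfl⟩ | ⟨f, rfl⟩) | ⟨f, rfl⟩) | ⟨f, rfl⟩ := hx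
        · rw [edg_mul_vtx]; split_ifs <;> simp only [me, m0]
        · rw [edg_mul_edg hE h]; exact m0
        · rw [edg_mul_gho hE h]; split_ifs <;> simp only [mp, m0]
        · rw [edg_mul_edgeProj hE h]; exact m0
      · change gho K E e * x ∈ P
        obtain ((⟨v', rfl⟩ | ⟨f, rfl⟩) | ⟨f, rfl⟩) | ⟨f, rfl⟩ := hx
        · rw [gho_mul_vtx]; split_ifs <;> simp only [mg, m0]
        · rw [gho_mul_edg]; split_ifs <;> simp only [mv, m0]
        · rw [gho_mul_gho hE h]; exact m0
        · rw [gho_mul_edgeProj]; split_ifs <;> simp only [mg, m0]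
    | zero => rw [mul_zero]; exact m0
    | add x y _ _ hx hy => rw [mul_add]; exact P.add_mem hx hy
    | smul c x _ hx => rw [mul_smul_comm]; exact P.smul_mem c hx
  have hgen : ∀ g : LeavittGen V W, mk K E (FreeLeavitt.gen K g) ∈ P := by
    rintro (v | e | e)
    exacts [mv v, me e, mg e]
  have hmon : ∀ m : FreeSemigroup (LeavittGen V W), mk K E (MonoidAlgebra.single m 1) ∈ P := by
    intro m
    induction m using FreeSemigroup.recOnMul with
    | ih1 g => exact hgen g
    | ih2 g m _ hm =>
      have : (MonoidAlgebra.single (FreeSemigroup.of g * m) 1 : FreeLeavitt K V W) =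
          FreeLeavitt.gen K g * MonoidAlgebra.single m 1 := by
        rw [FreeLeavitt.gen, MonoidAlgebra.single_mul_single, one_mul]
      rw [this]
      exact hmul g _ hm
  rw [eq_top_iff]
  rintro x -
  obtain ⟨a, rfl⟩ := mk_surjective K E x
  induction a using MonoidAlgebra.induction_linear with
  | zero => exact m0
  | add a b ha hb => exact P.add_mem ha hb
  | single m c =>
    have : (MonoidAlgebra.single m c : FreeLeavitt K V W) = c • MonoidAlgebra.single m 1 := by
      simp
    rw [this]
    exact P.smul_mem c (hmon m)

/-- Diagonal elements commute and scale `e` and `e*`; the only new brackets are `±[e, e*] = ±(ee* -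
r(e))`. -/
theorem lie_shortMonomials (hE : E.Acyclic) (h : LocallyLieSolvable K E) :
    ∀ x ∈ shortMonomials K E, ∀ y ∈ shortMonomials K E,
      ⁅x, y⁆ ∈ Submodule.span K (traceZeroMonomials K E) := by
  set P := Submodule.span K (traceZeroMonomials K E)
  have me : ∀ e, edg K E e ∈ P := fun e => Submodule.subset_span (by simp [traceZeroMonomials])
  have mg : ∀ e, gho K E e ∈ P := fun e => Submodule.subset_span (by simp [traceZeroMonomials])
  have md : ∀ e, vtx K E (E.r e) - edgeProj K E e ∈ P :=
    fun e => Submodule.subset_span (by simp [traceZeroMonomials, traceZeroDiagonal])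
  have md' : ∀ e, edgeProj K E e - vtx K E (E.r e) ∈ P := fun e => by
    rw [← neg_sub]; exact P.neg_mem (md e)
  rintro x (((⟨v, rfl⟩ | ⟨e, rfl⟩) | ⟨e, rfl⟩) | ⟨e, rfl⟩)
    y (((⟨v', rfl⟩ | ⟨f, rfl⟩) | ⟨f, rfl⟩) | ⟨f, rfl⟩) <;>
  simp only [lie_def, vtx_mul_vtx, vtx_mul_edg, edg_mul_vtx, vtx_mul_gho, gho_mul_vtx,
    gho_mul_edg, edg_mul_edg hE h, gho_mul_gho hE h, edg_mul_gho hE h, vtx_mul_edgeProj,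
    edgeProj_mul_vtx, edg_mul_edgeProj hE h, edgeProj_mul_gho hE h, edgeProj_mul_edg,
    gho_mul_edgeProj, edgeProj_mul_edgeProj] <;>
  (try split_ifs) <;> simp_all

/-- The brackets of `r(e) - ee*` with `e` and `e*` are `±2e` and `±2e*`, which vanish, so only the
diagonal survives. -/
theorem lie_traceZeroMonomials (hE : E.Acyclic) (h : LocallyLieSolvable K E) :
    ∀ x ∈ traceZeroMonomials K E, ∀ y ∈ traceZeroMonomials K E,
      ⁅x, y⁆ ∈ Submodule.span K (traceZeroDiagonal K E) := by
  set P := Submodule.span K (traceZeroDiagonal K E)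
  have md : ∀ e, vtx K E (E.r e) - edgeProj K E e ∈ P :=
    fun e => Submodule.subset_span (by simp [traceZeroDiagonal])
  have md' : ∀ e, edgeProj K E e - vtx K E (E.r e) ∈ P := fun e => by
    rw [← neg_sub]; exact P.neg_mem (md e)
  have h₂ : ∀ e, edg K E e + edg K E e = 0 := fun e => by
    rw [← two_smul K]; exact two_smul_edg hE h e
  -- Multiplying `2e = 0` by `e*` on the left gives `2r(e) = 0`, and then by `e*` on the right gives
  -- `2e* = 0`.
  have h₂' : ∀ e, gho K E e + gho K E e = 0 := fun e => by
    have hw : vtx K E (E.r e) + vtx K E (E.r e) = 0 := by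
      simpa [mul_add, gho_mul_edg] using congrArg (gho K E e * ·) (h₂ e)
    simpa [add_mul, range_mul_gho] using congrArg (· * gho K E e) hw
  rintro x ((⟨e, rfl⟩ | ⟨e, rfl⟩) | ⟨e, rfl⟩) y ((⟨f, rfl⟩ | ⟨f, rfl⟩) | ⟨f, rfl⟩) <;>
  simp only [lie_def, sub_mul, mul_sub, gho_mul_edg, edg_mul_edg hE h, gho_mul_gho hE h,
    edg_mul_gho hE h, range_mul_edg hE h, gho_mul_range hE h, edg_mul_range_eq hE h,
    range_mul_gho_eq hE h, edg_mul_edgeProj hE h, edgeProj_mul_gho hE h, edgeProj_mul_edg,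
    gho_mul_edgeProj, range_mul_range hE h, range_mul_edgeProj hE h, edgeProj_mul_range hE h,
    edgeProj_mul_edgeProj] <;>
  (try split_ifs) <;> simp_all [← neg_add']

theorem lie_traceZeroDiagonal (hE : E.Acyclic) (h : LocallyLieSolvable K E) :
    ∀ x ∈ traceZeroDiagonal K E, ∀ y ∈ traceZeroDiagonal K E,
      ⁅x, y⁆ ∈ (⊥ : Submodule K (LeavittPathAlgebra K E)) := by
  rintro _ ⟨e, rfl⟩ _ ⟨f, rfl⟩
  simp only [lie_def, sub_mul, mul_sub, range_mul_range hE h, range_mul_edgeProj hE h,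
    edgeProj_mul_range hE h, edgeProj_mul_edgeProj]
  split_ifs <;> simp_all

end LeavittPathAlgebra

theorem theorem4p8 {V : Type u} {W : Type v} (E : DirectedGraph V W) (hE : E.Acyclic)
    (K : Type w) [Field K] (h : LeavittPathAlgebra.LocallyLieSolvable K E) :
    LeavittPathAlgebra.LieSolvable K E := by
  open LeavittPathAlgebra in
  refine (LieAlgebra.isSolvable_iff K _).2 ⟨3, ?_⟩
  have h₁ := lieIdeal_lie_self_le (I := LieAlgebra.derivedSeries K (LeavittPathAlgebra K E) 0)
    (by rw [span_shortMonomials hE h]; exact le_top) (lie_shortMonomials hE h)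
  rw [← LieAlgebra.derivedSeriesOfIdeal_succ] at h₁
  have h₂ := lieIdeal_lie_self_le h₁ (lie_traceZeroMonomials hE h)
  rw [← LieAlgebra.derivedSeriesOfIdeal_succ] at h₂
  have h₃ := lieIdeal_lie_self_le h₂ (lie_traceZeroDiagonal hE h)
  rw [← LieAlgebra.derivedSeriesOfIdeal_succ] at h₃
  exact (LieSubmodule.toSubmodule_eq_bot _).1 (le_bot_iff.1 h₃)
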